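/- Let $R$ be a commutative Noetherian ring, let $\mathfrak a,\mathfrak b$ be ideals of $R$ and let $M$ be a finitely generated $R$-module. Write $V(\mathfrak a)$ for the set of primes containing $\mathfrak a$. A sequence $x_1,\dots,x_n$ in $R$ is an *$\mathfrak a$-filter regular $M$-sequence* if, for every $1\le i\le n$, $x_i\notin\mathfrak p$ for all $\mathfrak p\in\operatorname{Ass}\bigl(M/(x_1,\dots,x_{i-1})M\bigr)\setminus V(\mathfrak a)$; it is one *in $\mathfrak b$* if moreover all $x_i\in\mathfrak b$. The empty sequence, of length $0$, is allowed. Put $H^i_{\mathfrak b}(N,M)=\varinjlim_k\operatorname{Ext}^i_R(N/\mathfrak b^kN,M)$ and $H^i_{\mathfrak b}(M)=\varinjlim_k\operatorname{Ext}^i_R(R/\mathfrak b^k,M)$. (1) For every integer $n\ge 1$ the following are equivalent: (i) there is an $\mathfrak a$-filter regular $M$-sequence of length $n$ in $\mathfrak b$; (ii) every $\mathfrak a$-filter regular $M$-sequence in $\mathfrak b$ of length less than $n$ can be extended to an $\mathfrak a$-filter regular $M$-sequence of length $n$ in $\mathfrak b$; (iii) $\operatorname{Supp}\operatorname{Ext}^i_R(R/\mathfrak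 b,M)\subseteq V(\mathfrak a)$ for all $0\le i<n$; (iv) for every finitely generated $R$-module $N$ with $\operatorname{Supp}N=V(\mathfrak b)$, $\operatorname{Supp}\operatorname{Ext}^i_R(N,M)\subseteq V(\mathfrak a)$ for all $0\le i<n$; (v) $\operatorname{Supp}H^i_{\mathfrak b}(M)\subseteq V(\mathfrak a)$ for all $0\le i<n$; (vi) for every finitely generated $R$-module $N$ with $\operatorname{Ann}N\subseteq\mathfrak b$, $\operatorname{Supp}H^i_{\mathfrak b}(N,M)\subseteq V(\mathfrak a)$ for all $0\le i<n$. (2) Let $\operatorname{f-grade}_{\mathfrak a}(\mathfrak b,M)\in\{0,1,2,\dots\}\cup\{\infty\}$ be the supremum of the lengths of the $\mathfrak a$-filter regular $M$-sequences in $\mathfrak b$. One has $\operatorname{Supp}(M/\mathfrak bM)\subseteq V(\mathfrak a)$ if and only if for each $n\ge1$ there is an $\mathfrak a$-filter regular $M$-sequence of length $n$ in $\mathfrak b$, and in this case $\operatorname{f-grade}_{\mathfrak a}(\mathfrak b,M)=\infty$. If $\operatorname{Supp}(M/\mathfrak bM)\not\subseteq V(\mathfrak a)$, then every $\mathfrak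 a$-filter regular $M$-sequence in $\mathfrak b$ extends to a maximal one (one that cannot be prolonged by a further element of $\mathfrak b$), and all maximal ones have the same length, namely $\operatorname{f-grade}_{\mathfrak a}(\mathfrak b,M)$. (3) With $\inf\emptyset=\infty$, for every finitely generated $R$-module $N$, $$\operatorname{f-grade}_{\mathfrak a}(\operatorname{Ann}N,M)=\inf\{i\ge0:\operatorname{Supp}\operatorname{Ext}^i_R(N,M)\not\subseteq V(\mathfrak a)\},$$ $$\operatorname{f-grade}_{\mathfrak a}(\mathfrak b+\operatorname{Ann}N,M)=\inf\{i\ge0:\operatorname{Supp}H^i_{\mathfrak b}(N,M)\not\subseteq V(\mathfrak a)\},$$ and in particular $$\operatorname{f-grade}_{\mathfrak a}(\mathfrak b,M)=\inf\{i\ge0:\operatorname{Supp}\operatorname{Ext}^i_R(R/\mathfrak b,M)\not\subseteq V(\mathfrak a)\}=\inf\{i\ge0:\operatorname{Supp}H^i_{\mathfrak b}(M)\not\subseteq V(\mathfrak a)\}.$$ -/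

import Mathlib

universe u

section FilterRegular

variable {R : Type u} [CommRing R]

/-- `x₁, …, xₙ` is an `a`-filter regular `M`-sequence: `xᵢ ∉ p` for every `i` and every associated
prime `p` of `M / (x₁, …, xᵢ₋₁) M` that does not contain `a`. -/
def IsFilterRegular (a : Ideal R) (M : Type u) [AddCommGroup M] [Module R M]
    (xs : List R) : Prop :=
  ∀ (i : ℕ) (hi : i < xs.length),
    ∀ p ∈ associatedPrimes R (M ⧸ (Ideal.ofList (xs.take i) • (⊤ : Submodule R M))),
      ¬ a ≤ p → xs[i] ∉ p

/-- An `a`-filter regular `M`-sequence in `b`. The empty sequence (of length `0`) is one. -/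
def IsFilterRegularIn (a b : Ideal R) (M : Type u) [AddCommGroup M] [Module R M]
    (xs : List R) : Prop :=
  IsFilterRegular a M xs ∧ ∀ x ∈ xs, x ∈ b

/-- A maximal `a`-filter regular `M`-sequence in `b`: one which cannot be prolonged in `b`. -/
def IsMaximalFilterRegularIn (a b : Ideal R) (M : Type u) [AddCommGroup M] [Module R M]
    (xs : List R) : Prop :=
  IsFilterRegularIn a b M xs ∧ ∀ x : R, ¬ IsFilterRegularIn a b M (xs ++ [x])

/-- The `a`-filter grade of `b` on `M`, in `{0, 1, 2, …, ∞}`: the supremum of the lengths of the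
`a`-filter regular `M`-sequences in `b`. -/
noncomputable def filterGrade (a b : Ideal R) (M : Type u) [AddCommGroup M] [Module R M] : ℕ∞ :=
  ⨆ (xs : List R) (_ : IsFilterRegularIn a b M xs), (xs.length : ℕ∞)

end FilterRegular

section Cohomology

open CategoryTheory

variable {R : Type u} [CommRing R]

/-- The `R`-module `Ext^i_R(N, M)`. -/
abbrev ExtMod (R : Type u) [CommRing R] (i : ℕ) (N M : Type u) [AddCommGroup N] [Module R N]
    [AddCommGroup M] [Module R M] : Type u :=
  Abelian.Ext.{u} (ModuleCat.of R N) (ModuleCat.of R M) i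

/-- The `R`-linear map `Ext^i_R(N', M) → Ext^i_R(N, M)` induced by an `R`-linear map `N → N'`. -/
noncomputable def ExtMod.map (i : ℕ) {N N' : Type u} (M : Type u) [AddCommGroup N] [Module R N]
    [AddCommGroup N'] [Module R N'] [AddCommGroup M] [Module R M] (f : N →ₗ[R] N') :
    ExtMod R i N' M →ₗ[R] ExtMod R i N M :=
  (Abelian.Ext.mk₀ (ModuleCat.ofHom f)).precompOfLinear R (ModuleCat.of R M) (zero_add i)

/-- The natural projection `N / b^l N → N / b^k N` for `k ≤ l`. -/
def powQuotProj (b : Ideal R) (N : Type u) [AddCommGroup N] [Module R N] (k l : ℕ) (h : k ≤ l) :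
    (N ⧸ (b ^ l • (⊤ : Submodule R N))) →ₗ[R] (N ⧸ (b ^ k • (⊤ : Submodule R N))) :=
  Submodule.factor (Submodule.smul_mono_left (Ideal.pow_le_pow_right h))

/-- The transition map `Ext^i_R(N / b^k N, M) → Ext^i_R(N / b^l N, M)` for `k ≤ l`. -/
noncomputable def extPowTransition (b : Ideal R) (i : ℕ) (N M : Type u) [AddCommGroup N]
    [Module R N] [AddCommGroup M] [Module R M] (k l : ℕ) (h : k ≤ l) :
    ExtMod R i (N ⧸ (b ^ k • (⊤ : Submodule R N))) M →ₗ[R]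
      ExtMod R i (N ⧸ (b ^ l • (⊤ : Submodule R N))) M :=
  ExtMod.map i M (powQuotProj b N k l h)

instance extPowTransition_directedSystem (b : Ideal R) (i : ℕ) (N M : Type u) [AddCommGroup N]
    [Module R N] [AddCommGroup M] [Module R M] :
    DirectedSystem (fun k : ℕ => ExtMod R i (N ⧸ (b ^ k • (⊤ : Submodule R N))) M)
      (fun k l h => extPowTransition b i N M k l h) where
  map_self k x := by
    have h1 : powQuotProj b N k k le_rfl = LinearMap.id := by
      ext y
      simp [powQuotProj]
    simp only [extPowTransition, h1, ExtMod.map]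
    exact Abelian.Ext.mk₀_id_comp x
  map_map := by
    intro m l k hkl hlm x
    have h1 : powQuotProj b N k m (hkl.trans hlm)
        = powQuotProj b N k l hkl ∘ₗ powQuotProj b N l m hlm := by
      ext y
      simp [powQuotProj]
    simp only [extPowTransition, h1, ExtMod.map]
    rw [ModuleCat.ofHom_comp, ← Abelian.Ext.mk₀_comp_mk₀]
    simp

/-- Generalized local cohomology `H^i_b(N, M) = lim_k Ext^i_R(N / b^k N, M)` (direct limit). -/
abbrev GenLocalCohomology (b : Ideal R) (i : ℕ) (N M : Type u) [AddCommGroup N] [Module R N]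
    [AddCommGroup M] [Module R M] : Type u :=
  Module.DirectLimit (fun k : ℕ => ExtMod R i (N ⧸ (b ^ k • (⊤ : Submodule R N))) M)
    (extPowTransition b i N M)

/-- Local cohomology `H^i_b(M)`, the direct limit of the modules `Ext^i_R(R / b^k, M)`. -/
noncomputable abbrev LocalCohomologyMod (b : Ideal R) (i : ℕ) (M : Type u) [AddCommGroup M]
    [Module R M] : Type u :=
  (localCohomology b i).obj (ModuleCat.of R M)

end Cohomology

/-! Fix a prime `p` not containing `a`. Then `Supp X ⊆ V(a)` means that, for every such `p`, each
element of `X` is killed by something outside `p`: `X` vanishes at `p`. A filter regular `x` is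
injective on `M` up to such modules, so the classical theory of grade runs with "zero" replaced by
"vanishing at `p`".

Two facts carry the `Ext` criterion. If the elements of a filter regular sequence act nilpotently on
`N`, then `x` is both nilpotent and injective up to `p` on `Ext^i(N, M)`, which therefore vanishes
at `p` for `i` below the length (`IsFilterRegular.vanishesAt_ext`). Conversely, if `Hom(N, M)`
vanishes at every such `p`, no associated prime of `M` outside `V(a)` contains `Ann N`; prime
avoidance gives an element, and passing to `M/xM` costs one degree
(`exists_extension_of_vanishesAt_ext`). The second fact extends any given sequence, so maximal ones
have equal length.

For direct limits, vanishing of all `Ext^i(N/b^kN, M)` passes to the limit. In the other direction,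
a sequence of length `n` makes the transition maps injective up to `p` in degrees at most `n`, so
vanishing of the limit descends to `N/bN` and yields length `n + 1`
(`exists_isFilterRegularIn_iff_colimit`).

Maximal sequences exist by the ascending chain condition on the submodules `(x₁, …, xᵢ)M`. Since
`localCohomology` is built from the derived-functor `Ext`, that functor is first identified,
naturally, with `Abelian.Ext`. -/

section

open CategoryTheory Abelian
open scoped Pointwise

/-! ### Comparison of derived-functor `Ext` with `Abelian.Ext` -/

section
variable {R : Type u} [CommRing R] {X X' : ModuleCat.{u} R}

/-- The cocycles of `Hom(P, Y)`, as morphisms `Pₙ ⟶ Y`. -/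
noncomputable def cocycleHom (P : ProjectiveResolution X) (Y : ModuleCat.{u} R) (n : ℕ) :
    (P.complex.linearYonedaObj R Y).cycles n →ₗ[R] (P.complex.X n ⟶ Y) :=
  ((P.complex.linearYonedaObj R Y).iCycles n).hom

lemma cocycleHom_injective (P : ProjectiveResolution X) (Y : ModuleCat.{u} R) (n : ℕ) :
    Function.Injective (cocycleHom P Y n) :=
  (ModuleCat.mono_iff_injective ((P.complex.linearYonedaObj R Y).iCycles n)).1 inferInstance

lemma d_comp_cocycleHom (P : ProjectiveResolution X) (Y : ModuleCat.{u} R) (n m : ℕ)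
    (z : (P.complex.linearYonedaObj R Y).cycles n) :
    P.complex.d m n ≫ cocycleHom P Y n z = 0 :=
  ConcreteCategory.congr_hom ((P.complex.linearYonedaObj R Y).iCycles_d n m) z

lemma exists_cocycleHom_eq (P : ProjectiveResolution X) (Y : ModuleCat.{u} R) (n : ℕ)
    (f : P.complex.X n ⟶ Y) (hf : P.complex.d (n + 1) n ≫ f = 0) :
    ∃ z, cocycleHom P Y n z = f := by
  have h := (P.complex.linearYonedaObj R Y).cyclesIsKernel n (n + 1) (by simp)
  exact (ShortComplex.moduleCat_exact_iff _).1 (ShortComplex.exact_of_f_is_kernel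
    (.mk _ _ ((P.complex.linearYonedaObj R Y).iCycles_d n (n + 1))) h) f hf

lemma homologyπ_eq_zero_iff (P : ProjectiveResolution X) (Y : ModuleCat.{u} R) (n : ℕ)
    (z : (P.complex.linearYonedaObj R Y).cycles n) :
    (P.complex.linearYonedaObj R Y).homologyπ n z = 0 ↔
      ∃ g : P.complex.X ((ComplexShape.up ℕ).prev n) ⟶ Y,
        P.complex.d n _ ≫ g = cocycleHom P Y n z := by
  let K := P.complex.linearYonedaObj R Y
  constructor
  · intro h
    obtain ⟨g, hg⟩ := (ShortComplex.moduleCat_exact_iff _).1 (ShortComplex.exact_of_g_is_cokernel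
      (.mk _ _ (K.toCycles_comp_homologyπ _ n)) (K.homologyIsCokernel _ n rfl)) z h
    refine ⟨g, ?_⟩
    rw [← hg]
    exact (ConcreteCategory.congr_hom (K.toCycles_i _ n) g).symm
  · rintro ⟨g, hg⟩
    have : K.toCycles _ n g = z := by
      apply cocycleHom_injective
      rw [← hg]
      exact ConcreteCategory.congr_hom (K.toCycles_i _ n) g
    rw [← this]
    exact ConcreteCategory.congr_hom (K.toCycles_comp_homologyπ _ n) g

/-- There are no coboundaries in degree 0, because the cochain complex of `P` is zero in degree 1.
-/
lemma extMk_zero_eq_zero_iff (P : ProjectiveResolution X) {Y : ModuleCat.{u} R}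
    (f : P.complex.X 0 ⟶ Y) (hf : P.complex.d 1 0 ≫ f = 0) :
    P.extMk f 1 rfl hf = 0 ↔ f = 0 := by
  rw [← P.extEquivCohomologyClass.apply_eq_iff_eq,
    P.extEquivCohomologyClass_extMk, P.extEquivCohomologyClass_zero,
    CochainComplex.HomComplex.CohomologyClass.mk_eq_zero_iff,
    CochainComplex.HomComplex.Cocycle.toSingleMk_mem_coboundaries_iff _ _ _ _ _ 1 (by simp)]
  have hz : Limits.IsZero (P.cochainComplex.X 1) :=
    P.cochainComplex.isZero_of_isStrictlyLE 0 1
  refine ⟨fun ⟨g, hg⟩ => ?_, fun h => ⟨0, by simp [h]⟩⟩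
  rw [hz.eq_of_src g 0, Limits.comp_zero] at hg
  exact (cancel_epi (P.cochainComplexXIso 0 0 rfl).hom).1 (by simpa using hg.symm)

/-- The class in `Ext` of a cocycle of `Hom(P, Y)`. -/
noncomputable def extOfCycles (P : ProjectiveResolution X) (Y : ModuleCat.{u} R) (n : ℕ) :
    (P.complex.linearYonedaObj R Y).cycles n →ₗ[R] Abelian.Ext.{u} X Y n where
  toFun z := P.extMk (cocycleHom P Y n z) (n + 1) rfl (d_comp_cocycleHom P Y n _ z)
  map_add' x y := by
    rw [P.add_extMk]
    congr 1
    simp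
  map_smul' r x := by
    rw [RingHom.id_apply, Ext.smul_eq_comp_mk₀, P.extMk_comp_mk₀]
    congr 1
    simp

lemma extOfCycles_surjective (P : ProjectiveResolution X) (Y : ModuleCat.{u} R) (n : ℕ) :
    Function.Surjective (extOfCycles P Y n) := by
  intro x
  obtain ⟨f, hf, rfl⟩ := P.extMk_surjective x (n + 1) rfl
  obtain ⟨z, rfl⟩ := exists_cocycleHom_eq P Y n f hf
  exact ⟨z, rfl⟩

lemma extOfCycles_eq_zero_iff (P : ProjectiveResolution X) (Y : ModuleCat.{u} R) (n : ℕ)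
    (z : (P.complex.linearYonedaObj R Y).cycles n) :
    extOfCycles P Y n z = 0 ↔ (P.complex.linearYonedaObj R Y).homologyπ n z = 0 := by
  rw [homologyπ_eq_zero_iff]
  cases n with
  | zero =>
    refine (extMk_zero_eq_zero_iff P _ (d_comp_cocycleHom P Y 0 _ z)).trans ?_
    -- Here `prev 0 = 0` and `d 0 0 = 0`, so being a coboundary means being zero.
    simp [eq_comm]
  | succ n =>
    refine (P.extMk_eq_zero_iff _ _ rfl (d_comp_cocycleHom P Y (n + 1) _ z) n rfl).trans ?_
    have : (ComplexShape.up ℕ).prev (n + 1) = n := by simp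
    rw [this]

/-- `Ext` as the cohomology of `Hom(P, Y)`, for a projective resolution `P`. -/
noncomputable def homologyEquivExt (P : ProjectiveResolution X) (Y : ModuleCat.{u} R) (n : ℕ) :
    (P.complex.linearYonedaObj R Y).homology n ≃ₗ[R] Abelian.Ext.{u} X Y n :=
  (LinearMap.quotKerEquivOfSurjective ((P.complex.linearYonedaObj R Y).homologyπ n).hom
    ((ModuleCat.epi_iff_surjective _).1 inferInstance)).symm ≪≫ₗ
  Submodule.quotEquivOfEq _ _ (by
    ext z; exact (extOfCycles_eq_zero_iff P Y n z).symm) ≪≫ₗ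
  LinearMap.quotKerEquivOfSurjective (extOfCycles P Y n) (extOfCycles_surjective P Y n)

lemma homologyEquivExt_homologyπ (P : ProjectiveResolution X) (Y : ModuleCat.{u} R) (n : ℕ)
    (z : (P.complex.linearYonedaObj R Y).cycles n) :
    homologyEquivExt P Y n ((P.complex.linearYonedaObj R Y).homologyπ n z) =
      extOfCycles P Y n z := by
  have : (LinearMap.quotKerEquivOfSurjective ((P.complex.linearYonedaObj R Y).homologyπ n).hom
    ((ModuleCat.epi_iff_surjective _).1 inferInstance)).symm
      ((P.complex.linearYonedaObj R Y).homologyπ n z) = Submodule.Quotient.mk z := by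
    rw [LinearEquiv.symm_apply_eq]
    rfl
  simp only [homologyEquivExt, LinearEquiv.trans_apply]
  erw [this]
  rfl

/-- The morphism between unopposite complexes induced by a morphism of complexes in `Vᵒᵖ`. -/
def HomologicalComplex.unopMap {V ι : Type*} [Category* V] [Abelian V] {c : ComplexShape ι}
    {K L : HomologicalComplex Vᵒᵖ c} (ψ : K ⟶ L) : L.unop ⟶ K.unop :=
  (HomologicalComplex.unopFunctor V c).map ψ.op

/-- The map of complexes `Hom(P, Y) ⟶ Hom(P', Y)` induced by a map of complexes `P' ⟶ P`. -/
noncomputable def linearYonedaMap {P' P : ChainComplex (ModuleCat.{u} R) ℕ} (φ : P' ⟶ P)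
    (Y : ModuleCat.{u} R) : P.linearYonedaObj R Y ⟶ P'.linearYonedaObj R Y :=
  HomologicalComplex.unopMap
    ((((linearYoneda R (ModuleCat.{u} R)).obj Y).rightOp.mapHomologicalComplex _).map φ)

/-- Every class is represented by a cocycle, and on cocycles both sides are precomposition with the
lift of `g` to the resolutions. -/
lemma homologyEquivExt_naturality {P' : ProjectiveResolution X'} {P : ProjectiveResolution X}
    {g : X' ⟶ X} (φ : ProjectiveResolution.Hom P' P g) (Y : ModuleCat.{u} R) (n : ℕ)
    (x : (P.complex.linearYonedaObj R Y).homology n) :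
    homologyEquivExt P' Y n (HomologicalComplex.homologyMap (linearYonedaMap φ.hom Y) n x) =
      (Ext.mk₀ g).comp (homologyEquivExt P Y n x) (zero_add n) := by
  obtain ⟨z, rfl⟩ := (ModuleCat.epi_iff_surjective _).1
    (inferInstance : Epi ((P.complex.linearYonedaObj R Y).homologyπ n)) x
  have h1 : HomologicalComplex.homologyMap (linearYonedaMap φ.hom Y) n
      ((P.complex.linearYonedaObj R Y).homologyπ n z) =
      (P'.complex.linearYonedaObj R Y).homologyπ n
        (HomologicalComplex.cyclesMap (linearYonedaMap φ.hom Y) n z) :=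
    ConcreteCategory.congr_hom
      (HomologicalComplex.homologyπ_naturality (linearYonedaMap φ.hom Y) n) z
  have h2 : cocycleHom P' Y n (HomologicalComplex.cyclesMap (linearYonedaMap φ.hom Y) n z) =
      φ.hom.f n ≫ cocycleHom P Y n z :=
    ConcreteCategory.congr_hom
      (HomologicalComplex.cyclesMap_i (linearYonedaMap φ.hom Y) n) z
  rw [h1, homologyEquivExt_homologyπ, homologyEquivExt_homologyπ]
  refine Eq.trans ?_
    (ProjectiveResolution.mk₀_comp_extMk _ _ rfl (d_comp_cocycleHom P Y n _ z) φ).symm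
  simp only [extOfCycles, LinearMap.coe_mk, AddHom.coe_mk]
  congr 1

lemma homologyUnop_naturality {V ι : Type*} [Category* V] [Abelian V] {c : ComplexShape ι}
    {K L : HomologicalComplex Vᵒᵖ c} (ψ : K ⟶ L) (i : ι) :
    (HomologicalComplex.homologyMap ψ i).unop ≫ (HomologicalComplex.homologyUnop K i).inv =
      (HomologicalComplex.homologyUnop L i).inv ≫
        HomologicalComplex.homologyMap (HomologicalComplex.unopMap ψ) i := by
  rw [Iso.comp_inv_eq, Category.assoc, Iso.eq_inv_comp]
  exact (congrArg Quiver.Hom.unop (HomologicalComplex.homologyOp_hom_naturality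
    (HomologicalComplex.unopMap ψ) i))

/-- `isoExt` is the computation of a left derived functor into the opposite category, followed by
moving homology through `unop`; each half has its own naturality square. -/
lemma isoExt_naturality {P' : ProjectiveResolution X'} {P : ProjectiveResolution X}
    {g : X' ⟶ X} (φ : ProjectiveResolution.Hom P' P g) (Y : ModuleCat.{u} R) (n : ℕ) :
    ((_root_.Ext R (ModuleCat.{u} R) n).map g.op).app Y ≫ (P'.isoExt n Y).hom =
      (P.isoExt n Y).hom ≫ HomologicalComplex.homologyMap (linearYonedaMap φ.hom Y) n := by
  let F := ((linearYoneda R (ModuleCat.{u} R)).obj Y).rightOp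
  have h : ((F.leftDerived n).map g).unop ≫ (P'.isoLeftDerivedObj F n).inv.unop =
      (P.isoLeftDerivedObj F n).inv.unop ≫
        (HomologicalComplex.homologyMap ((F.mapHomologicalComplex _).map φ.hom) n).unop :=
    congrArg Quiver.Hom.unop (ProjectiveResolution.isoLeftDerivedObj_inv_naturality g P' P
      φ.hom (by simpa using φ.hom_f_zero_comp_π_f_zero) F n)
  have h' := homologyUnop_naturality ((F.mapHomologicalComplex _).map φ.hom) n
  -- Stated for arbitrary morphisms, since `h` and `h'` match the goal only after unfolding
  -- definitions.
  have paste {A B C A' B' C' : ModuleCat.{u} R} {a : A ⟶ A'} {b : A' ⟶ B'} {c : A ⟶ B}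
      {d : B ⟶ B'} {e : B' ⟶ C'} {f : B ⟶ C} {k : C ⟶ C'} (h₁ : a ≫ b = c ≫ d)
      (h₂ : d ≫ e = f ≫ k) : a ≫ b ≫ e = (c ≫ f) ≫ k := by
    rw [Category.assoc, ← h₂, reassoc_of% h₁]
  exact paste h h'

/-- The derived functor `Ext` agrees with `Abelian.Ext`. -/
noncomputable def derivedExtEquiv (P : ProjectiveResolution X) (Y : ModuleCat.{u} R) (n : ℕ) :
    ((_root_.Ext R (ModuleCat.{u} R) n).obj (.op X)).obj Y ≃ₗ[R] Abelian.Ext.{u} X Y n :=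
  (P.isoExt n Y).toLinearEquiv ≪≫ₗ homologyEquivExt P Y n

lemma derivedExtEquiv_naturality (P' : ProjectiveResolution X') (P : ProjectiveResolution X)
    (g : X' ⟶ X) (Y : ModuleCat.{u} R) (n : ℕ)
    (x : ((_root_.Ext R (ModuleCat.{u} R) n).obj (.op X)).obj Y) :
    derivedExtEquiv P' Y n (((_root_.Ext R (ModuleCat.{u} R) n).map g.op).app Y x) =
      (Ext.mk₀ g).comp (derivedExtEquiv P Y n x) (zero_add n) := by
  let φ : ProjectiveResolution.Hom P' P g :=
    { hom := ProjectiveResolution.lift g P' P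
      hom_f_zero_comp_π_f_zero :=
        HomologicalComplex.congr_hom (ProjectiveResolution.lift_commutes g P' P) 0 }
  rw [derivedExtEquiv, derivedExtEquiv, LinearEquiv.trans_apply, LinearEquiv.trans_apply,
    ← homologyEquivExt_naturality φ]
  exact congrArg (homologyEquivExt P' Y n) (ConcreteCategory.congr_hom (isoExt_naturality φ Y n) x)

end

/-! ### Functoriality of `Ext` and local cohomology as a direct limit -/

section
variable {R : Type u} [CommRing R]

lemma ExtMod.map_id (i : ℕ) (N M : Type u) [AddCommGroup N] [Module R N] [AddCommGroup M]
    [Module R M] (x : ExtMod R i N M) : ExtMod.map i M (LinearMap.id (R := R) (M := N)) x = x :=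
  Ext.mk₀_id_comp x

lemma ExtMod.map_comp (i : ℕ) {N N' N'' : Type u} (M : Type u) [AddCommGroup N] [Module R N]
    [AddCommGroup N'] [Module R N'] [AddCommGroup N''] [Module R N''] [AddCommGroup M]
    [Module R M] (f : N →ₗ[R] N') (g : N' →ₗ[R] N'') (x : ExtMod R i N'' M) :
    ExtMod.map i M (g ∘ₗ f) x = ExtMod.map i M f (ExtMod.map i M g x) := by
  simp only [ExtMod.map, ModuleCat.ofHom_comp, ← Ext.mk₀_comp_mk₀]
  simp

/-- The linear equivalence on `Ext` induced by a linear equivalence in the first argument. -/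
noncomputable def ExtMod.congrLeft (i : ℕ) {N N' : Type u} (M : Type u) [AddCommGroup N]
    [Module R N] [AddCommGroup N'] [Module R N'] [AddCommGroup M] [Module R M] (e : N ≃ₗ[R] N') :
    ExtMod R i N' M ≃ₗ[R] ExtMod R i N M :=
  LinearEquiv.ofLinearMap (ExtMod.map i M e.toLinearMap) (ExtMod.map i M e.symm.toLinearMap)
    (by ext x; simp [← ExtMod.map_comp, ExtMod.map_id])
    (by ext x; simp [← ExtMod.map_comp, ExtMod.map_id])

/-- Local cohomology as the direct limit of the modules `Ext^i(R / b^k, M)`, elementwise. -/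
lemma exists_localCohomology_cocone (b : Ideal R) (i : ℕ) (M : Type u) [AddCommGroup M]
    [Module R M] :
    ∃ c : ∀ k : ℕ, ExtMod R i (R ⧸ (b ^ k • (⊤ : Submodule R R))) M →ₗ[R]
      LocalCohomologyMod b i M,
      (∀ z, ∃ k x, c k x = z) ∧
      ∀ k x, c k x = 0 → ∃ (l : ℕ) (h : k ≤ l), extPowTransition b i R M k l h x = 0 := by
  let I := localCohomology.idealPowersDiagram b
  let D := localCohomology.diagram I i
  let Y := ModuleCat.of R M
  let P (k : ℕ) : ProjectiveResolution (ModuleCat.of R (R ⧸ b ^ k)) := projectiveResolution _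
  have : Limits.HasColimit D := localCohomology.hasColimitDiagram.{u, 0} I i
  let hc : Limits.IsColimit (((evaluation _ _).obj Y).mapCocone (Limits.colimit.cocone D)) :=
    Limits.isColimitOfPreserves _ (Limits.colimit.isColimit D)
  let e (k : ℕ) : (R ⧸ b ^ k) ≃ₗ[R] (R ⧸ (b ^ k • (⊤ : Submodule R R))) :=
    Submodule.quotEquivOfEq _ _ (by simp)
  let E (k : ℕ) : ExtMod R i (R ⧸ (b ^ k • (⊤ : Submodule R R))) M ≃ₗ[R]
      ((_root_.Ext R (ModuleCat.{u} R) i).obj (.op (ModuleCat.of R (R ⧸ b ^ k)))).obj Y :=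
    ExtMod.congrLeft i M (e k) ≪≫ₗ (derivedExtEquiv (P k) Y i).symm
  let ι (k : ℕ) : ((_root_.Ext R (ModuleCat.{u} R) i).obj (.op (ModuleCat.of R (R ⧸ b ^ k)))).obj Y
      ⟶ (localCohomology b i).obj Y :=
    (((evaluation _ _).obj Y).mapCocone (Limits.colimit.cocone D)).ι.app (.op (.op k))
  have : Limits.PreservesFilteredColimitsOfSize.{0, 0} (forget (ModuleCat.{u} R)) :=
    Limits.preservesFilteredColimitsOfSize_shrink.{0, u, 0, u} _
  have : Limits.PreservesColimit (D ⋙ (evaluation _ _).obj Y) (forget (ModuleCat.{u} R)) :=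
    inferInstance
  -- The identifications `E` carry `extPowTransition` to the transition maps of the diagram defining
  -- `localCohomology`.
  have hE (k l : ℕ) (f : Opposite.op (Opposite.op k) ⟶ Opposite.op (Opposite.op l)) (h : k ≤ l)
      (x) : (D.map f).app Y (E k x) = E l (extPowTransition b i R M k l h x) := by
    let g : (R ⧸ b ^ l) →ₗ[R] (R ⧸ b ^ k) :=
      Submodule.mapQ _ _ LinearMap.id (Ideal.pow_le_pow_right h)
    refine ((derivedExtEquiv (P l) Y i).eq_symm_apply).2 ?_
    refine (derivedExtEquiv_naturality (P l) (P k) (ModuleCat.ofHom g) Y i _).trans ?_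
    have hk : derivedExtEquiv (P k) Y i (E k x) = ExtMod.map i M (e k).toLinearMap x :=
      (derivedExtEquiv (P k) Y i).apply_symm_apply _
    rw [hk]
    refine (ExtMod.map_comp i M g (e k).toLinearMap x).symm.trans
      (Eq.trans ?_ (ExtMod.map_comp i M (e l).toLinearMap (powQuotProj b R k l h) x))
    congr 2
    ext
    rfl
  refine ⟨fun k => (ι k).hom ∘ₗ (E k).toLinearMap, fun z => ?_, fun k x hx => ?_⟩
  · obtain ⟨j, y, hy⟩ := Limits.Concrete.isColimit_exists_rep _ hc z
    refine ⟨j.unop.unop, (E _).symm y, ?_⟩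
    exact (congrArg (ι j.unop.unop) ((E j.unop.unop).apply_symm_apply y)).trans hy
  · obtain ⟨j, f, g, hfg⟩ := Limits.Concrete.isColimit_exists_of_rep_eq.{u} _
      (i := .op (.op k)) (j := .op (.op k)) hc (E k x) 0
      (hx.trans (map_zero (ι k).hom).symm)
    -- The index category is `ℕ` made opposite twice, so its arrows are inequalities in the usual
    -- direction.
    have h : k ≤ j.unop.unop := f.unop.unop.down.down
    refine ⟨_, h, (E j.unop.unop).injective ?_⟩
    rw [← hE k _ f h, map_zero]
    exact hfg.trans (map_zero ((D.map g).app Y).hom)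

lemma exists_genLocalCohomology_cocone (b : Ideal R) (i : ℕ) (N M : Type u) [AddCommGroup N]
    [Module R N] [AddCommGroup M] [Module R M] :
    ∃ c : ∀ k : ℕ, ExtMod R i (N ⧸ (b ^ k • (⊤ : Submodule R N))) M →ₗ[R]
      GenLocalCohomology b i N M,
      (∀ z, ∃ k x, c k x = z) ∧
      ∀ k x, c k x = 0 → ∃ (l : ℕ) (h : k ≤ l), extPowTransition b i N M k l h x = 0 :=
  ⟨Module.DirectLimit.of R ℕ _ (extPowTransition b i N M), Module.DirectLimit.exists_of,
    fun _ _ hx => Module.DirectLimit.of.zero_exact hx⟩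
end

/-! ### Vanishing at a prime, associated primes, prime avoidance -/

section
variable {R : Type u} [CommRing R]

/-- Every element of `X` is killed by an element outside of `p`. -/
def VanishesAt (p : Ideal R) (X : Type*) [AddCommGroup X] [Module R X] : Prop :=
  ∀ x : X, ∃ r ∉ p, r • x = 0

lemma support_subset_zeroLocus_iff (a : Ideal R) (X : Type*) [AddCommGroup X] [Module R X] :
    Module.support R X ⊆ PrimeSpectrum.zeroLocus (a : Set R) ↔
      ∀ p : Ideal R, p.IsPrime → ¬ a ≤ p → VanishesAt p X := by
  constructor
  · intro h p hp hap
    by_contra hv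
    refine hap (h (a := ⟨p, hp⟩) (not_not.1 fun hs => hv ?_))
    exact Module.notMem_support_iff'.1 hs
  · intro h p hp
    by_contra hap
    exact Module.notMem_support_iff'.2 (h p.asIdeal p.2 hap) hp

lemma mem_of_isAssociatedPrime_of_smul_eq_zero {p : Ideal R} {M : Type*} [AddCommGroup M]
    [Module R M] (hp : IsAssociatedPrime p M) {x : R} (hx : ∀ m : M, x • m = 0) : x ∈ p := by
  obtain ⟨hp, m, rfl⟩ := hp
  exact Ideal.le_radical (by simp [Submodule.mem_colon_singleton, hx])

lemma exists_mul_annihilates {M : Type*} [AddCommGroup M] [Module R M] [Module.Finite R M]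
    {p : Ideal R} [p.IsPrime] (h : VanishesAt p M) : ∃ r ∉ p, ∀ m : M, r • m = 0 := by
  by_contra! H
  have hs : (⟨p, inferInstance⟩ : PrimeSpectrum R) ∉ Module.support R M :=
    Module.notMem_support_iff'.2 h
  refine hs (Module.mem_support_iff_of_finite.2 fun r hr => ?_)
  by_contra hrp
  obtain ⟨m, hm⟩ := H r hrp
  exact hm (Module.mem_annihilator.1 hr m)

open scoped TensorProduct in
-- As `p` lies in the support, `κ(p) ⊗ N` is nonzero and has a nonzero functional. This gives a
-- nonzero map from `N` to the fraction field of `R/p`; clearing the denominators of finitely many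
-- generators lands it in `R/p`.
lemma exists_linearMap_quotient_ne_zero {N : Type*} [AddCommGroup N] [Module R N]
    [Module.Finite R N] {p : Ideal R} [p.IsPrime]
    (hN : Module.annihilator R N ≤ p) : ∃ (f : N →ₗ[R] R ⧸ p) (n : N), f n ≠ 0 := by
  have : Nontrivial (p.ResidueField ⊗[R] N) :=
    (Module.mem_support_iff_nontrivial_residueField_tensorProduct (R := R) (M := N)
      ⟨p, inferInstance⟩).1 (Module.mem_support_iff_of_finite.2 hN)
  obtain ⟨t, ht⟩ := exists_ne (0 : p.ResidueField ⊗[R] N)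
  obtain ⟨φ, hφ⟩ := Module.Projective.exists_dual_ne_zero p.ResidueField ht
  let g : N →ₗ[R] p.ResidueField :=
    φ.restrictScalars R ∘ₗ TensorProduct.mk R p.ResidueField N 1
  obtain ⟨n, hn⟩ : ∃ n, g n ≠ 0 := by
    by_contra! H
    refine hφ ?_
    clear hφ ht
    induction t with
    | zero => exact map_zero φ
    | add x y hx hy => rw [map_add, hx, hy, add_zero]
    | tmul k n =>
      have : k ⊗ₜ[R] n = k • ((1 : p.ResidueField) ⊗ₜ[R] n) := by
        rw [TensorProduct.smul_tmul', smul_eq_mul, mul_one]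
      rw [this, map_smul]
      exact (congrArg (k • ·) (H n)).trans (smul_zero k)
  obtain ⟨m, s, hs⟩ := Module.Finite.exists_fin (R := R) (M := N)
  obtain ⟨b, hb⟩ := IsLocalization.exist_integer_multiples_of_finite (nonZeroDivisors (R ⧸ p))
    (fun i => g (s i))
  obtain ⟨r, hr⟩ := Ideal.Quotient.mk_surjective b.1
  let ι : (R ⧸ p) →ₗ[R] p.ResidueField := (Algebra.linearMap (R ⧸ p) _).restrictScalars R
  have hι : Function.Injective ι := p.injective_algebraMap_quotient_residueField
  have hsmul (k : p.ResidueField) : r • k = b.1 • k := by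
    rw [← hr]
    exact (algebraMap_smul (R ⧸ p) r k).symm
  have hrange (x : N) : (r • g) x ∈ LinearMap.range ι := by
    have : (⊤ : Submodule R N) ≤ (LinearMap.range ι).comap (r • g) := by
      rw [← hs, Submodule.span_le]
      rintro _ ⟨i, rfl⟩
      obtain ⟨y, hy⟩ := hb i
      exact ⟨y, hy.trans (hsmul _).symm⟩
    exact this trivial
  let e := LinearEquiv.ofInjective ι hι
  let f : N →ₗ[R] R ⧸ p := e.symm.toLinearMap ∘ₗ (r • g).codRestrict _ hrange
  refine ⟨f, n, fun h0 => ?_⟩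
  have h1 : (r • g).codRestrict _ hrange n = 0 := e.symm.map_eq_zero_iff.1 h0
  have h2 : b.1 • g n = 0 := (hsmul _).symm.trans (congrArg Subtype.val h1)
  rw [Algebra.smul_def, mul_eq_zero] at h2
  rcases h2 with h2 | h2
  · exact nonZeroDivisors.ne_zero b.2 (hι (h2.trans (map_zero ι).symm))
  · exact hn h2

variable [IsNoetherianRing R]

lemma exists_associatedPrime_le {M : Type*} [AddCommGroup M] [Module R M] [Module.Finite R M]
    {p : Ideal R} [p.IsPrime] (h : ¬ VanishesAt p M) : ∃ q ∈ associatedPrimes R M, q ≤ p := by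
  have hs : (⟨p, inferInstance⟩ : PrimeSpectrum R) ∈ Module.support R M := by
    by_contra hs
    exact h (Module.notMem_support_iff'.1 hs)
  obtain ⟨q, hq, hqp⟩ := Ideal.exists_minimalPrimes_le (Module.mem_support_iff_of_finite.1 hs)
  exact ⟨q, Module.associatedPrimes.minimalPrimes_annihilator_subset_associatedPrimes R M hq, hqp⟩

/-- `x` is a filter regular element: it avoids the associated primes of `M` outside `V(a)`. -/
def IsFilterRegularElement (a : Ideal R) (M : Type u) [AddCommGroup M] [Module R M] (x : R) :
    Prop :=
  ∀ p ∈ associatedPrimes R M, ¬ a ≤ p → x ∉ p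

/-- Otherwise some associated prime of the kernel lies inside `p`. It contains `x`, is associated to
`M`, and does not contain `a`. -/
lemma IsFilterRegularElement.vanishesAt_ker {a : Ideal R} {M : Type u} [AddCommGroup M]
    [Module R M] [Module.Finite R M] {x : R} (hx : IsFilterRegularElement a M x) {p : Ideal R}
    [p.IsPrime] (hp : ¬ a ≤ p) : VanishesAt p (LinearMap.lsmul R M x).ker := by
  by_contra h
  obtain ⟨q, hq, hqp⟩ := exists_associatedPrime_le h
  refine hx q (IsAssociatedPrime.map_of_injective (Submodule.subtype _) hq
    (Submodule.subtype_injective _)) (fun h => hp (h.trans hqp))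
    (mem_of_isAssociatedPrime_of_smul_eq_zero hq ?_)
  rintro ⟨m, hm⟩
  exact Subtype.ext hm

lemma exists_isFilterRegularElement (a c : Ideal R) (M : Type u) [AddCommGroup M] [Module R M]
    [Module.Finite R M] (h : ∀ p ∈ associatedPrimes R M, ¬ a ≤ p → ¬ c ≤ p) :
    ∃ x ∈ c, IsFilterRegularElement a M x := by
  have hfin : {p ∈ associatedPrimes R M | ¬ a ≤ p}.Finite :=
    (associatedPrimes.finite R M).subset (Set.sep_subset _ _)
  by_contra! H
  have hsub : (c : Set R) ⊆ ⋃ p ∈ {p ∈ associatedPrimes R M | ¬ a ≤ p}, (p : Set R) := by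
    intro x hx
    have := H x hx
    simp only [IsFilterRegularElement, not_forall, not_not] at this
    obtain ⟨p, hp, hap, hxp⟩ := this
    exact Set.mem_biUnion (show p ∈ {p ∈ associatedPrimes R M | ¬ a ≤ p} from ⟨hp, hap⟩) hxp
  -- Prime avoidance allows two non-prime exceptions; all ideals here are prime, so `⊥ ⊥` are
  -- placeholders.
  obtain ⟨p, hp, hcp⟩ := (Ideal.subset_union_prime_finite hfin ⊥ ⊥
    (fun p hp _ _ => hp.1.isPrime)).1 hsub
  exact h p hp.1 hp.2 hcp

/-- Compose a nonzero map `N → R/p` with an embedding `R/p → M`; since `R/p` is a domain, no `r ∉ p`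
kills the result. -/
lemma exists_linearMap_of_associatedPrime {N M : Type*} [AddCommGroup N] [Module R N]
    [Module.Finite R N] [AddCommGroup M] [Module R M] {p : Ideal R}
    (hp : p ∈ associatedPrimes R M) (hN : Module.annihilator R N ≤ p) :
    ∃ f : N →ₗ[R] M, ∀ r ∉ p, r • f ≠ 0 := by
  have := hp.isPrime
  obtain ⟨f, n, hn⟩ := exists_linearMap_quotient_ne_zero hN
  obtain ⟨-, m, hm⟩ := isAssociatedPrime_iff.1 hp
  have hm' : p = LinearMap.ker (LinearMap.toSpanSingleton R M m) := by
    rw [hm]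
    ext r
    simp [Submodule.mem_colon_singleton]
  let g : R ⧸ p →ₗ[R] M := p.liftQ (LinearMap.toSpanSingleton R M m) hm'.le
  have hg : Function.Injective g :=
    LinearMap.ker_eq_bot.1 (Submodule.ker_liftQ_eq_bot _ _ _ hm'.ge)
  refine ⟨g ∘ₗ f, fun r hr h => ?_⟩
  have h1 : r • f n = 0 := hg (by simpa using LinearMap.congr_fun h n)
  obtain ⟨s, hs⟩ := Ideal.Quotient.mk_surjective (f n)
  rw [← hs] at h1 hn
  have h2 : Ideal.Quotient.mk p (r * s) = 0 := h1
  rw [Ideal.Quotient.eq_zero_iff_mem] at h2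
  exact hn (Ideal.Quotient.eq_zero_iff_mem.2 ((Ideal.IsPrime.mem_or_mem ‹_› h2).resolve_left hr))

end

/-! ### Filter regular sequences, taken apart at either end -/

section
variable {R : Type u} [CommRing R]

lemma isFilterRegularElement_iff_of_equiv {a : Ideal R} {M M' : Type u} [AddCommGroup M] [Module R M]
    [AddCommGroup M'] [Module R M'] (x : R) (e : M ≃ₗ[R] M') :
    IsFilterRegularElement a M x ↔ IsFilterRegularElement a M' x := by
  rw [IsFilterRegularElement, IsFilterRegularElement, LinearEquiv.AssociatedPrimes.eq e]

/-- The isomorphism of `M/(x, x₁, …, xᵢ)M` with the quotient of `M/xM` by `(x₁, …, xᵢ)` allows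
induction with `M` replaced by `M/xM`. -/
lemma isFilterRegular_cons_iff (a : Ideal R) (M : Type u) [AddCommGroup M] [Module R M] (x : R)
    (xs : List R) :
    IsFilterRegular a M (x :: xs) ↔
      IsFilterRegularElement a M x ∧ IsFilterRegular a (QuotSMulTop x M) xs := by
  have e0 : M ≃ₗ[R] (M ⧸ (Ideal.ofList ((x :: xs).take 0) • (⊤ : Submodule R M))) :=
    (Submodule.quotEquivOfEqBot _ (by simp)).symm
  constructor
  · intro h
    refine ⟨?_, fun i hi => ?_⟩
    · exact (isFilterRegularElement_iff_of_equiv x e0).2 (h 0 (by simp))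
    · exact (isFilterRegularElement_iff_of_equiv (xs[i])
        (Submodule.quotOfListConsSMulTopEquivQuotSMulTopInner M x (xs.take i))).1
        (h (i + 1) (by simpa using hi))
  · rintro ⟨h0, h⟩ (_ | i) hi
    · exact (isFilterRegularElement_iff_of_equiv x e0).1 h0
    · exact (isFilterRegularElement_iff_of_equiv (xs[i]'(by simpa using hi))
        (Submodule.quotOfListConsSMulTopEquivQuotSMulTopInner M x (xs.take i))).2
        (h i (by simpa using hi))

lemma isFilterRegular_nil (a : Ideal R) (M : Type u) [AddCommGroup M] [Module R M] :
    IsFilterRegular a M [] := by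
  intro i hi
  simp at hi

lemma isFilterRegular_append_singleton_iff (a : Ideal R) (M : Type u) [AddCommGroup M]
    [Module R M] (xs : List R) (x : R) :
    IsFilterRegular a M (xs ++ [x]) ↔ IsFilterRegular a M xs ∧
      IsFilterRegularElement a (M ⧸ (Ideal.ofList xs • (⊤ : Submodule R M))) x := by
  constructor
  · intro h
    refine ⟨fun i hi p hp hap => ?_, fun p hp hap => ?_⟩
    · have := h i (by simp; omega) p
      rw [List.take_append_of_le_length hi.le, List.getElem_append_left hi] at this
      exact this hp hap
    · have := h xs.length (by simp) p
      rw [List.take_left] at this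
      simp only [List.getElem_concat_length] at this
      exact this hp hap
  · rintro ⟨h1, h2⟩ i hi p hp hap
    rcases Nat.lt_or_ge i xs.length with hi' | hi'
    · rw [List.getElem_append_left hi']
      rw [List.take_append_of_le_length hi'.le] at hp
      exact h1 i hi' p hp hap
    · obtain rfl : i = xs.length := by simp at hi; omega
      rw [List.take_left] at hp
      simpa using h2 p hp hap

end

/-! ### Filter regular sequences and vanishing of `Ext` -/

section
variable {R : Type u} [CommRing R]

lemma shortExact_of_exact {A B C : Type u} [AddCommGroup A] [Module R A] [AddCommGroup B]
    [Module R B] [AddCommGroup C] [Module R C] {f : A →ₗ[R] B} {g : B →ₗ[R] C}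
    (hf : Function.Injective f) (hg : Function.Surjective g) (h : Function.Exact f g) :
    (ShortComplex.mk (ModuleCat.ofHom f) (ModuleCat.ofHom g)
      (by ext x; exact h.apply_apply_eq_zero x)).ShortExact where
  exact := (ShortComplex.moduleCat_exact_iff _).2 fun x hx => (h x).1 hx
  mono_f := (ModuleCat.mono_iff_injective _).2 hf
  epi_g := (ModuleCat.epi_iff_surjective _).2 hg

lemma smul_ext_eq_zero_of_right {N M : Type u} [AddCommGroup N] [Module R N] [AddCommGroup M]
    [Module R M] {r : R} (hr : ∀ m : M, r • m = 0) {i : ℕ} (z : ExtMod R i N M) : r • z = 0 := by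
  have : r • 𝟙 (ModuleCat.of R M) = 0 := by ext m; exact hr m
  rw [Ext.smul_eq_comp_mk₀, this]
  simp

lemma smul_ext_eq_zero_of_left {N M : Type u} [AddCommGroup N] [Module R N] [AddCommGroup M]
    [Module R M] {r : R} (hr : ∀ n : N, r • n = 0) {i : ℕ} (z : ExtMod R i N M) : r • z = 0 := by
  have : r • 𝟙 (ModuleCat.of R N) = 0 := by ext m; exact hr m
  rw [← Ext.mk₀_id_comp z, ← Ext.smul_comp, ← Ext.mk₀_smul, this]
  simp

lemma vanishesAt_ext_of_right {N M : Type u} [AddCommGroup N] [Module R N] [AddCommGroup M]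
    [Module R M] [Module.Finite R M] {p : Ideal R} [p.IsPrime] (h : VanishesAt p M) (i : ℕ) :
    VanishesAt p (ExtMod R i N M) := by
  obtain ⟨r, hr, hM⟩ := exists_mul_annihilates h
  exact fun z => ⟨r, hr, smul_ext_eq_zero_of_right hM z⟩

section
variable (N M : Type u) [AddCommGroup N] [Module R N] [AddCommGroup M] [Module R M] (x : R)

lemma shortExact_ker_range :
    (ShortComplex.mk (ModuleCat.ofHom (LinearMap.lsmul R M x).ker.subtype)
      (ModuleCat.ofHom (LinearMap.lsmul R M x).rangeRestrict)
      (by ext m; exact m.2)).ShortExact :=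
  shortExact_of_exact (Submodule.subtype_injective _) (LinearMap.surjective_rangeRestrict _)
    (by
      intro m
      rw [← LinearMap.mem_ker, LinearMap.ker_rangeRestrict]
      simp)

lemma exact_range_quotSMulTop : Function.Exact (LinearMap.lsmul R M x).range.subtype
    (x • (⊤ : Submodule R M)).mkQ := by
  intro m
  simp [Submodule.mem_smul_pointwise_iff_exists]

lemma shortExact_range_quotSMulTop :
    (ShortComplex.mk (ModuleCat.ofHom (LinearMap.lsmul R M x).range.subtype)
      (ModuleCat.ofHom (x • (⊤ : Submodule R M)).mkQ)
      (by ext m; exact (exact_range_quotSMulTop M x).apply_apply_eq_zero m)).ShortExact :=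
  shortExact_of_exact (Submodule.subtype_injective _) (Submodule.mkQ_surjective _)
    (exact_range_quotSMulTop M x)

variable {N M x}

/-- Multiplication by `x` factors as `M → xM → M`. On `Ext^i(N, -)` the kernel of the second map
comes from `Ext^{i-1}(N, M/xM)` and that of the first from `Ext^i(N, ker x)`; both vanish at `p`.
Writing `j + 1 = i` makes the first condition empty when `i = 0`. -/
lemma exists_smul_ext_eq_zero {p : Ideal R} [p.IsPrime] [IsNoetherianRing R] [Module.Finite R M]
    (hx : VanishesAt p (LinearMap.lsmul R M x).ker) {i : ℕ}
    (hi : ∀ j, j + 1 = i → VanishesAt p (ExtMod R j N (QuotSMulTop x M)))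
    (z : ExtMod R i N M) (hz : x • z = 0) : ∃ r ∉ p, r • z = 0 := by
  let ι := Ext.mk₀ (ModuleCat.ofHom (LinearMap.lsmul R M x).range.subtype)
  let π := Ext.mk₀ (ModuleCat.ofHom (LinearMap.lsmul R M x).rangeRestrict)
  let w := z.comp π (add_zero i)
  have hw : w.comp ι (add_zero i) = 0 := by
    rw [← hz, Ext.smul_eq_comp_mk₀]
    simp only [w, π, ι, Ext.comp_assoc_of_third_deg_zero, Ext.mk₀_comp_mk₀]
    rfl
  have h1 : ∃ s ∉ p, s • w = 0 := by
    cases i with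
    | zero =>
      have : Mono (ModuleCat.ofHom (LinearMap.lsmul R M x).range.subtype) :=
        (ModuleCat.mono_iff_injective _).2 (Submodule.subtype_injective _)
      refine ⟨1, p.one_notMem, ?_⟩
      rw [one_smul]
      exact Ext.postcomp_mk₀_injective_of_mono (ModuleCat.of R N)
        (ModuleCat.ofHom (LinearMap.lsmul R M x).range.subtype) (a₁ := w) (a₂ := 0)
        (hw.trans (map_zero (Ext.postcomp _ _ (add_zero 0))).symm)
    | succ j =>
      obtain ⟨v, hv⟩ := Ext.covariant_sequence_exact₁ _ (shortExact_range_quotSMulTop M x) w hw rfl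
      obtain ⟨s, hs, hsv⟩ := hi j rfl v
      refine ⟨s, hs, ?_⟩
      rw [← hv, ← Ext.smul_comp, hsv, Ext.zero_comp]
  obtain ⟨s, hs, hsw⟩ := h1
  have h2 : (s • z).comp π (add_zero i) = 0 := by rw [Ext.smul_comp]; exact hsw
  obtain ⟨v, hv⟩ := Ext.covariant_sequence_exact₂ _ (shortExact_ker_range M x) (s • z) h2
  obtain ⟨r, hr, hrv⟩ := vanishesAt_ext_of_right (N := N) hx i v
  refine ⟨r * s, fun h => ((Ideal.IsPrime.mem_or_mem ‹_› h).elim hr hs), ?_⟩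
  rw [mul_smul, ← hv, ← Ext.smul_comp, hrv, Ext.zero_comp]

lemma vanishesAt_ext_quotSMulTop {p : Ideal R} [p.IsPrime] [IsNoetherianRing R]
    [Module.Finite R M]
    (hx : VanishesAt p (LinearMap.lsmul R M x).ker) {i : ℕ}
    (h0 : VanishesAt p (ExtMod R i N M)) (h1 : VanishesAt p (ExtMod R (i + 1) N M)) :
    VanishesAt p (ExtMod R i N (QuotSMulTop x M)) := by
  intro y
  let w := y.comp (shortExact_range_quotSMulTop M x).extClass rfl
  -- The obstruction to lifting `w` from `Ext^{i+1}(N, xM)` to `Ext^{i+1}(N, M)` lies in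
  -- `Ext^{i+2}(N, ker x)`, which vanishes at `p`.
  obtain ⟨s, hs, hsw⟩ := vanishesAt_ext_of_right (N := N) hx (i + 2)
    (w.comp (shortExact_ker_range M x).extClass rfl)
  rw [← Ext.smul_comp] at hsw
  obtain ⟨v, hv⟩ := Ext.covariant_sequence_exact₃ _ (shortExact_ker_range M x) (s • w) rfl hsw
  obtain ⟨t, ht, htv⟩ := h1 v
  have h2 : ((t * s) • y).comp (shortExact_range_quotSMulTop M x).extClass rfl = 0 := by
    rw [Ext.smul_comp, mul_smul]
    change t • s • w = 0
    rw [← hv, ← Ext.smul_comp, htv, Ext.zero_comp]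
  obtain ⟨u, hu⟩ := Ext.covariant_sequence_exact₃ _ (shortExact_range_quotSMulTop M x) _ rfl h2
  obtain ⟨r, hr, hru⟩ := h0 u
  refine ⟨r * (t * s), fun h => (Ideal.IsPrime.mem_or_mem ‹_› h).elim hr
    fun h => (Ideal.IsPrime.mem_or_mem ‹_› h).elim ht hs, ?_⟩
  rw [mul_smul, ← hu, ← Ext.smul_comp, hru, Ext.zero_comp]

end

variable [IsNoetherianRing R]

lemma IsFilterRegular.vanishesAt_ext {a : Ideal R} {xs : List R} :
    ∀ {M : Type u} [AddCommGroup M] [Module R M] [Module.Finite R M], IsFilterRegular a M xs →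
    ∀ {N : Type u} [AddCommGroup N] [Module R N],
    (∀ x ∈ xs, x ∈ (Module.annihilator R N).radical) → ∀ {p : Ideal R} [p.IsPrime], ¬ a ≤ p →
    ∀ {i : ℕ}, i < xs.length → VanishesAt p (ExtMod R i N M) := by
  induction xs with
  | nil => intro _ _ _ _ _ _ _ _ _ _ _ _ _ hi; simp at hi
  | cons x xs ih =>
    intro M _ _ _ hreg N _ _ hN p _ hap i hi z
    rw [isFilterRegular_cons_iff] at hreg
    obtain ⟨t, ht⟩ := hN x (by simp)
    -- Injectivity up to `p` strips one factor of `x` at a time; some power `x ^ t` kills `N`, hence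
    -- all of `Ext`.
    have key (k : ℕ) : ∀ z : ExtMod R i N M, x ^ k • z = 0 → ∃ r ∉ p, r • z = 0 := by
      induction k with
      | zero => exact fun z hz => ⟨1, p.one_notMem, by simpa using hz⟩
      | succ k ihk =>
        intro z hz
        obtain ⟨r, hr, hrz⟩ := ihk (x • z) (by rwa [smul_smul, ← pow_succ])
        obtain ⟨s, hs, hsz⟩ := exists_smul_ext_eq_zero (hreg.1.vanishesAt_ker hap)
          (fun j hj => ih hreg.2 (fun y hy => hN y (by simp [hy])) hap
            (by simp at hi; omega)) (r • z) (by rwa [smul_comm])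
        exact ⟨s * r, fun h => (Ideal.IsPrime.mem_or_mem ‹_› h).elim hs hr,
          by rwa [mul_smul]⟩
    exact key t z (smul_ext_eq_zero_of_left (Module.mem_annihilator.1 ht) z)

/-- An associated prime of `M` outside `V(a)` containing `c` would contain `Ann N`, giving a map `N
→ M` that survives at that prime. -/
lemma exists_isFilterRegularElement_of_vanishesAt_hom {a c : Ideal R} {N M : Type u}
    [AddCommGroup N] [Module R N] [Module.Finite R N] [AddCommGroup M] [Module R M]
    [Module.Finite R M] (hN : Module.annihilator R N ≤ c.radical)
    (h : ∀ p : Ideal R, p.IsPrime → ¬ a ≤ p → VanishesAt p (ExtMod R 0 N M)) :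
    ∃ x ∈ c, IsFilterRegularElement a M x := by
  refine exists_isFilterRegularElement a c M fun p hp hap hcp => ?_
  have := hp.isPrime
  obtain ⟨f, hf⟩ := exists_linearMap_of_associatedPrime hp
    (hN.trans (Ideal.IsPrime.radical_le_iff ‹_› |>.2 hcp))
  obtain ⟨r, hr, hrz⟩ := h p ‹_› hap (Ext.mk₀ (ModuleCat.ofHom f))
  refine hf r hr ?_
  rw [← Ext.mk₀_smul] at hrz
  have h0 : r • ModuleCat.ofHom f = 0 := by
    refine (Ext.mk₀_bijective _ _).1 (hrz.trans ?_)
    simp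
  simpa using congrArg ModuleCat.Hom.hom h0

/-- Each step passes to `M/xM` and uses up one degree of vanishing. The element `x` is the head of
the given list while one remains, and afterwards comes from the vanishing of `Hom`. -/
lemma exists_extension_of_vanishesAt_ext {a c : Ideal R} {N : Type u}
    [AddCommGroup N] [Module R N] [Module.Finite R N]
    (hN : Module.annihilator R N ≤ c.radical) (n : ℕ) :
    ∀ {M : Type u} [AddCommGroup M] [Module R M] [Module.Finite R M],
    (∀ i < n, ∀ p : Ideal R, p.IsPrime → ¬ a ≤ p → VanishesAt p (ExtMod R i N M)) →
    ∀ xs : List R, IsFilterRegularIn a c M xs → xs.length ≤ n →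
      ∃ ys : List R, (xs ++ ys).length = n ∧ IsFilterRegularIn a c M (xs ++ ys) := by
  induction n with
  | zero =>
    intro M _ _ _ _ xs hxs hl
    exact ⟨[], by simpa using hl, by simpa using hxs⟩
  | succ n ih =>
    intro M _ _ _ h xs hxs hl
    have step (x : R) (hx : IsFilterRegularElement a M x) (i : ℕ) (hi : i < n) (p : Ideal R)
        (hp : p.IsPrime) (hap : ¬ a ≤ p) : VanishesAt p (ExtMod R i N (QuotSMulTop x M)) :=
      vanishesAt_ext_quotSMulTop (hx.vanishesAt_ker hap) (h i (by omega) p hp hap)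
        (h (i + 1) (by omega) p hp hap)
    have glue (x : R) (xs ys : List R) (hxc : x ∈ c) (hx : IsFilterRegularElement a M x)
        (hys : IsFilterRegularIn a c (QuotSMulTop x M) (xs ++ ys)) :
        IsFilterRegularIn a c M (x :: xs ++ ys) :=
      ⟨(isFilterRegular_cons_iff ..).2 ⟨hx, hys.1⟩, List.forall_mem_cons.2 ⟨hxc, hys.2⟩⟩
    cases xs with
    | nil =>
      obtain ⟨x, hxc, hx⟩ := exists_isFilterRegularElement_of_vanishesAt_hom hN (h 0 (by omega))
      obtain ⟨ys, hys, hreg⟩ := ih (step x hx) [] ⟨isFilterRegular_nil a _, by simp⟩ (by simp)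
      exact ⟨x :: ys, by simpa using hys, glue x [] ys hxc hx hreg⟩
    | cons x xs =>
      have hx := (isFilterRegular_cons_iff ..).1 hxs.1
      obtain ⟨ys, hys, hreg⟩ := ih (step x hx.1) xs
        ⟨hx.2, fun y hy => hxs.2 y (by simp [hy])⟩ (by simpa using hl)
      exact ⟨ys, by simpa using hys, glue x xs ys (hxs.2 x (by simp)) hx.1 hreg⟩

end

/-! ### Direct limits, filter grade and maximal sequences -/

section
variable {R : Type u} [CommRing R]

/-- In the long exact sequence, the kernel of the transition map is the image of `Ext^{i-1}(K, M)`,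
where `K` is the kernel of the projection. -/
lemma exists_smul_eq_zero_of_extPowTransition_eq_zero {b : Ideal R} {N M : Type u}
    [AddCommGroup N] [Module R N] [AddCommGroup M] [Module R M] {p : Ideal R} [p.IsPrime]
    {k l : ℕ} (h : k ≤ l) {i : ℕ}
    (hi : ∀ j, j + 1 = i → VanishesAt p (ExtMod R j (LinearMap.ker (powQuotProj b N k l h)) M))
    (z : ExtMod R i (N ⧸ (b ^ k • (⊤ : Submodule R N))) M)
    (hz : extPowTransition b i N M k l h z = 0) : ∃ r ∉ p, r • z = 0 := by
  have hsurj : Function.Surjective (powQuotProj b N k l h) :=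
    Submodule.factor_surjective (Submodule.smul_mono_left (Ideal.pow_le_pow_right h))
  cases i with
  | zero =>
    have : Epi (ModuleCat.ofHom (powQuotProj b N k l h)) :=
      (ModuleCat.epi_iff_surjective _).2 hsurj
    refine ⟨1, p.one_notMem, ?_⟩
    rw [one_smul]
    exact Ext.precomp_mk₀_injective_of_epi (ModuleCat.of R M)
      (ModuleCat.ofHom (powQuotProj b N k l h)) (a₁ := z) (a₂ := 0)
      (hz.trans (map_zero (Ext.precomp _ _ (zero_add 0))).symm)
  | succ j =>
    obtain ⟨v, hv⟩ := Ext.contravariant_sequence_exact₃ (shortExact_of_exact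
      (Submodule.subtype_injective _) hsurj (LinearMap.exact_subtype_ker_map _)) _ z hz
      (add_comm 1 j)
    obtain ⟨r, hr, hrv⟩ := hi j rfl v
    exact ⟨r, hr, by rw [← hv, ← Ext.comp_smul, hrv, Ext.comp_zero]⟩

lemma le_radical_annihilator_quotient_pow (b : Ideal R) (N : Type u) [AddCommGroup N] [Module R N]
    (k : ℕ) : b ⊔ Module.annihilator R N ≤
      (Module.annihilator R (N ⧸ (b ^ k • (⊤ : Submodule R N)))).radical := by
  refine sup_le (fun x hx => ⟨k, Module.mem_annihilator.2 fun n => ?_⟩)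
    (le_trans (fun x hx => Module.mem_annihilator.2 fun n => ?_) Ideal.le_radical)
  · obtain ⟨n, rfl⟩ := Submodule.mkQ_surjective _ n
    rw [← map_smul]
    exact (Submodule.Quotient.mk_eq_zero _).2
      (Submodule.smul_mem_smul (Ideal.pow_mem_pow hx k) trivial)
  · obtain ⟨n, rfl⟩ := Submodule.mkQ_surjective _ n
    rw [← map_smul, Module.mem_annihilator.1 hx, map_zero]

/-- For finitely generated `N`, `Supp(N/bN) = Supp N ∩ V(b)`. Exponent 1 is used because `N/b^0N =
0` carries no information. -/
lemma annihilator_quotient_pow_one_le (b : Ideal R) (N : Type u) [AddCommGroup N] [Module R N]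
    [Module.Finite R N] : Module.annihilator R (N ⧸ (b ^ 1 • (⊤ : Submodule R N))) ≤
      (b ⊔ Module.annihilator R N).radical := by
  rw [Ideal.radical_eq_sInf]
  refine le_sInf fun p ⟨hp, hprime⟩ => ?_
  refine Module.annihilator_le_of_mem_support (p := ⟨p, hprime⟩) ?_
  rw [Module.support_quotient, pow_one]
  exact ⟨Module.mem_support_iff_of_finite.2 (le_sup_right.trans hp), le_sup_left.trans hp⟩

lemma IsFilterRegularIn.of_append {a b : Ideal R} {M : Type u} [AddCommGroup M]
    [Module R M] {xs ys : List R} (h : IsFilterRegularIn a b M (xs ++ ys)) :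
    IsFilterRegularIn a b M xs := by
  refine ⟨fun i hi p hp hap => ?_, fun x hx => h.2 x (List.mem_append_left _ hx)⟩
  have := h.1 i (by simp; omega) p
  rw [List.take_append_of_le_length hi.le, List.getElem_append_left hi] at this
  exact this hp hap

lemma filterGrade_eq_iInf {a c : Ideal R} {M : Type u} [AddCommGroup M] [Module R M]
    {P : ℕ → Prop}
    (h : ∀ n, (∃ xs : List R, xs.length = n ∧ IsFilterRegularIn a c M xs) ↔ ∀ i < n, P i) :
    filterGrade a c M = ⨅ (i : ℕ) (_ : ¬ P i), (i : ℕ∞) := by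
  have hle (n : ℕ) (hn : ∀ i < n, P i) : (n : ℕ∞) ≤ filterGrade a c M := by
    obtain ⟨xs, rfl, hxs⟩ := (h n).2 hn
    exact le_iSup₂_of_le xs hxs le_rfl
  refine le_antisymm (iSup₂_le fun xs hxs => le_iInf₂ fun i hi => ?_) ?_
  · by_contra! hlt
    exact hi ((h xs.length).1 ⟨xs, rfl, hxs⟩ i (by exact_mod_cast hlt))
  · by_cases hP : ∃ i, ¬ P i
    · classical
      exact (iInf₂_le (Nat.find hP) (Nat.find_spec hP)).trans
        (hle _ fun i hi => not_not.1 (Nat.find_min hP hi))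
    · push Not at hP
      rw [ENat.eq_top_iff_forall_ge.2 fun n => hle n fun i _ => hP i]
      exact le_top

variable [IsNoetherianRing R]

/-- The existence of long filter regular sequences is detected by `Ext`. -/
lemma exists_isFilterRegularIn_iff_ext (a c : Ideal R) (M N : Type u) [AddCommGroup M] [Module R M]
    [Module.Finite R M] [AddCommGroup N] [Module R N] [Module.Finite R N]
    (h1 : c ≤ (Module.annihilator R N).radical) (h2 : Module.annihilator R N ≤ c.radical) (n : ℕ) :
    (∃ xs : List R, xs.length = n ∧ IsFilterRegularIn a c M xs) ↔
      ∀ i < n, Module.support R (ExtMod R i N M) ⊆ PrimeSpectrum.zeroLocus (a : Set R) := by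
  simp only [support_subset_zeroLocus_iff]
  constructor
  · rintro ⟨xs, rfl, hxs⟩ i hi p hp hap
    exact hxs.1.vanishesAt_ext (fun x hx => h1 (hxs.2 x hx)) hap hi
  · intro h
    obtain ⟨ys, hys⟩ := exists_extension_of_vanishesAt_ext h2 n h []
      ⟨isFilterRegular_nil a _, by simp⟩ (by simp)
    exact ⟨_, hys⟩

/-- Only the elementwise description of the limit matters, so `L` is abstract and covers both local
and generalized local cohomology. -/
lemma exists_isFilterRegularIn_iff_colimit (a b : Ideal R) (M N : Type u) [AddCommGroup M]
    [Module R M] [Module.Finite R M] [AddCommGroup N] [Module R N] [Module.Finite R N]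
    {c : Ideal R} (hc : c = b ⊔ Module.annihilator R N)
    (L : ℕ → Type u) [∀ i, AddCommGroup (L i)] [∀ i, Module R (L i)]
    (hL : ∀ i, ∃ c : ∀ k : ℕ, ExtMod R i (N ⧸ (b ^ k • (⊤ : Submodule R N))) M →ₗ[R] L i,
      (∀ z, ∃ k x, c k x = z) ∧
      ∀ k x, c k x = 0 → ∃ (l : ℕ) (h : k ≤ l), extPowTransition b i N M k l h x = 0) (n : ℕ) :
    (∃ xs : List R, xs.length = n ∧ IsFilterRegularIn a c M xs) ↔
      ∀ i < n, Module.support R (L i) ⊆ PrimeSpectrum.zeroLocus (a : Set R) := by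
  subst hc
  simp only [support_subset_zeroLocus_iff]
  constructor
  · rintro ⟨xs, rfl, hxs⟩ i hi p hp hap z
    obtain ⟨f, hf, -⟩ := hL i
    obtain ⟨k, x, rfl⟩ := hf z
    obtain ⟨r, hr, hrx⟩ := hxs.1.vanishesAt_ext
      (fun y hy => le_radical_annihilator_quotient_pow b N k (hxs.2 y hy)) hap hi x
    exact ⟨r, hr, by rw [← map_smul, hrx, map_zero]⟩
  · induction n with
    | zero => exact fun _ => ⟨[], rfl, isFilterRegular_nil a _, by simp⟩
    | succ n ih =>
      intro h
      obtain ⟨xs, hl, hxs⟩ := ih fun i hi => h i (by omega)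
      have key (i : ℕ) (hi : i < n + 1) (p : Ideal R) (hp : p.IsPrime) (hap : ¬ a ≤ p) :
          VanishesAt p (ExtMod R i (N ⧸ (b ^ 1 • (⊤ : Submodule R N))) M) := by
        intro z
        obtain ⟨f, -, hf⟩ := hL i
        obtain ⟨r, hr, hrz⟩ := h i hi p hp hap (f 1 z)
        rw [← map_smul] at hrz
        obtain ⟨l, hl1, hz⟩ := hf 1 _ hrz
        -- The kernel sits inside `N/b^lN`, so the elements of `xs` act nilpotently on it, and `j <
        -- n` is below the length of `xs`.
        have hker (j : ℕ) (hj : j + 1 = i) :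
            VanishesAt p (ExtMod R j (LinearMap.ker (powQuotProj b N 1 l hl1)) M) := by
          refine hxs.1.vanishesAt_ext (fun y hy => ?_) hap (by omega)
          exact Ideal.radical_mono
            (LinearMap.annihilator_le_of_injective _ (Submodule.subtype_injective _))
            (le_radical_annihilator_quotient_pow b N l (hxs.2 y hy))
        obtain ⟨s, hs, hsz⟩ := exists_smul_eq_zero_of_extPowTransition_eq_zero hl1 hker (r • z) hz
        exact ⟨s * r, fun h => (hp.mem_or_mem h).elim hs hr, by rwa [mul_smul]⟩
      obtain ⟨ys, hys⟩ := exists_extension_of_vanishesAt_ext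
        (annihilator_quotient_pow_one_le b N) (n + 1) key []
        ⟨isFilterRegular_nil a _, by simp⟩ (by simp)
      exact ⟨_, hys⟩

/-- An associated prime of `M` containing `b` lies in `Supp(M/bM)`, hence in `V(a)`, so avoidance
always gives an element; the hypothesis passes to `M/xM`. -/
lemma exists_isFilterRegularIn_of_support (a b : Ideal R) (n : ℕ) :
    ∀ (M : Type u) [AddCommGroup M] [Module R M] [Module.Finite R M],
    Module.support R (M ⧸ (b • (⊤ : Submodule R M))) ⊆ PrimeSpectrum.zeroLocus (a : Set R) →
    ∃ xs : List R, xs.length = n ∧ IsFilterRegularIn a b M xs := by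
  induction n with
  | zero => exact fun M _ _ _ _ => ⟨[], rfl, isFilterRegular_nil a _, by simp⟩
  | succ n ih =>
    intro M _ _ _ h
    obtain ⟨x, hxb, hx⟩ := exists_isFilterRegularElement a b M fun p hp hap hbp => by
      refine hap (h (a := ⟨p, hp.isPrime⟩) ?_)
      rw [Module.support_quotient]
      exact ⟨Module.mem_support_iff_of_finite.2 fun r hr =>
        mem_of_isAssociatedPrime_of_smul_eq_zero hp (Module.mem_annihilator.1 hr), hbp⟩
    obtain ⟨xs, hl, hxs⟩ := ih (QuotSMulTop x M) (by
      rw [Module.support_quotient] at h ⊢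
      exact (Set.inter_subset_inter_left _ (Module.support_subset_of_surjective
        (Submodule.mkQ _) (Submodule.mkQ_surjective _))).trans h)
    exact ⟨x :: xs, by simp [hl], (isFilterRegular_cons_iff ..).2 ⟨hx, hxs.1⟩,
      List.forall_mem_cons.2 ⟨hxb, hxs.2⟩⟩

/-- If the submodule did not grow, `x` would kill `M/(xs)M` while being injective on it up to `p`.
That quotient, and with it `M/bM`, would vanish at every `p` outside `V(a)`. -/
lemma ofList_smul_top_lt_of_isFilterRegularIn {a b : Ideal R} {M : Type u} [AddCommGroup M]
    [Module R M] [Module.Finite R M]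
    (h : ¬ Module.support R (M ⧸ (b • (⊤ : Submodule R M))) ⊆ PrimeSpectrum.zeroLocus (a : Set R))
    {xs : List R} {x : R} (hx : IsFilterRegularIn a b M (xs ++ [x])) :
    Ideal.ofList xs • (⊤ : Submodule R M) < Ideal.ofList (xs ++ [x]) • (⊤ : Submodule R M) := by
  refine lt_of_le_of_ne ?_ fun heq => h ?_
  · rw [Ideal.ofList_append]
    exact Submodule.smul_mono_left le_sup_left
  · rw [support_subset_zeroLocus_iff]
    intro p hp hap y
    have hx' := ((isFilterRegular_append_singleton_iff ..).1 hx.1).2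
    obtain ⟨m, rfl⟩ := Submodule.mkQ_surjective _ y
    have hker : Submodule.Quotient.mk m ∈ LinearMap.ker (LinearMap.lsmul R
        (M ⧸ (Ideal.ofList xs • (⊤ : Submodule R M))) x) := by
      refine (Submodule.Quotient.mk_eq_zero _).2 ?_
      rw [heq]
      exact Submodule.smul_mem_smul (Ideal.subset_span (by simp)) trivial
    obtain ⟨r, hr, hrm⟩ := hx'.vanishesAt_ker hap ⟨_, hker⟩
    refine ⟨r, hr, ?_⟩
    have hrm' : Submodule.Quotient.mk (r • m) = 0 := congrArg Subtype.val hrm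
    rw [Submodule.Quotient.mk_eq_zero] at hrm'
    rw [← map_smul]
    refine (Submodule.Quotient.mk_eq_zero _).2 (Submodule.smul_mono_left ?_ hrm')
    exact Ideal.span_le.2 fun y hy => hx.2 y (List.mem_append_left _ hy)

lemma exists_isMaximalFilterRegularIn {a b : Ideal R} {M : Type u} [AddCommGroup M]
    [Module R M] [Module.Finite R M]
    (h : ¬ Module.support R (M ⧸ (b • (⊤ : Submodule R M))) ⊆ PrimeSpectrum.zeroLocus (a : Set R))
    {xs : List R} (hxs : IsFilterRegularIn a b M xs) :
    ∃ ys : List R, IsMaximalFilterRegularIn a b M (xs ++ ys) := by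
  induction hS : Ideal.ofList xs • (⊤ : Submodule R M) using WellFoundedGT.induction
    generalizing xs with
  | ind S ih =>
    subst hS
    by_cases hmax : ∀ x : R, ¬ IsFilterRegularIn a b M (xs ++ [x])
    · exact ⟨[], by simpa using ⟨hxs, hmax⟩⟩
    · push Not at hmax
      obtain ⟨x, hx⟩ := hmax
      obtain ⟨ys, hys⟩ := ih _ (ofList_smul_top_lt_of_isFilterRegularIn h hx) hx rfl
      exact ⟨x :: ys, by simpa using hys⟩

/-- Filter regular sequences extend to the length of any other one. -/
lemma IsFilterRegularIn.exists_extension {a b : Ideal R} {M : Type u} [AddCommGroup M]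
    [Module R M] [Module.Finite R M] {zs : List R} (hzs : IsFilterRegularIn a b M zs)
    {xs : List R} (hxs : IsFilterRegularIn a b M xs) (hl : xs.length ≤ zs.length) :
    ∃ ys : List R, (xs ++ ys).length = zs.length ∧ IsFilterRegularIn a b M (xs ++ ys) :=
  exists_extension_of_vanishesAt_ext (N := R ⧸ b)
    (by rw [Ideal.annihilator_quotient]; exact Ideal.le_radical) zs.length
    (fun _ hi _ hp hap => hzs.1.vanishesAt_ext (fun x hx => by
      rw [Ideal.annihilator_quotient]; exact Ideal.le_radical (hzs.2 x hx)) hap hi) xs hxs hl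

lemma IsMaximalFilterRegularIn.length_le {a b : Ideal R} {M : Type u} [AddCommGroup M]
    [Module R M] [Module.Finite R M] {xs : List R} (hxs : IsMaximalFilterRegularIn a b M xs)
    {zs : List R} (hzs : IsFilterRegularIn a b M zs) : zs.length ≤ xs.length := by
  by_contra! hlt
  obtain ⟨ys, hl, hys⟩ := hzs.exists_extension hxs.1 hlt.le
  cases ys with
  | nil => simp at hl; omega
  | cons y ys =>
    rw [List.append_cons] at hys
    exact hxs.2 y hys.of_append

end

end

/-! ### Assembly of the equivalences and grade formulas -/

theorem theorem2p2 {R : Type u} [CommRing R] [IsNoetherianRing R] (a b : Ideal R)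
    (M : Type u) [AddCommGroup M] [Module R M] [Module.Finite R M] :
    -- the equivalences
    (∀ n : ℕ, 1 ≤ n → List.TFAE
      [ ∃ xs : List R, xs.length = n ∧ IsFilterRegularIn a b M xs,
        ∀ xs : List R, IsFilterRegularIn a b M xs → xs.length < n →
          ∃ ys : List R, (xs ++ ys).length = n ∧ IsFilterRegularIn a b M (xs ++ ys),
        ∀ i < n, Module.support R (ExtMod R i (R ⧸ b) M) ⊆
          PrimeSpectrum.zeroLocus (a : Set R),
        ∀ (N : Type u) [AddCommGroup N] [Module R N] [Module.Finite R N],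
          Module.support R N = PrimeSpectrum.zeroLocus (b : Set R) →
          ∀ i < n, Module.support R (ExtMod R i N M) ⊆ PrimeSpectrum.zeroLocus (a : Set R),
        ∀ i < n, Module.support R (LocalCohomologyMod b i M) ⊆
          PrimeSpectrum.zeroLocus (a : Set R),
        ∀ (N : Type u) [AddCommGroup N] [Module R N] [Module.Finite R N],
          Module.annihilator R N ≤ b →
          ∀ i < n, Module.support R (GenLocalCohomology b i N M) ⊆
            PrimeSpectrum.zeroLocus (a : Set R) ]) ∧
    -- the filter grade is well defined
    (Module.support R (M ⧸ (b • (⊤ : Submodule R M))) ⊆ PrimeSpectrum.zeroLocus (a : Set R) ↔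
      ∀ n : ℕ, 1 ≤ n → ∃ xs : List R, xs.length = n ∧ IsFilterRegularIn a b M xs) ∧
    (Module.support R (M ⧸ (b • (⊤ : Submodule R M))) ⊆ PrimeSpectrum.zeroLocus (a : Set R) →
      filterGrade a b M = ⊤) ∧
    (¬ Module.support R (M ⧸ (b • (⊤ : Submodule R M))) ⊆
        PrimeSpectrum.zeroLocus (a : Set R) →
      (∀ xs : List R, IsFilterRegularIn a b M xs →
        ∃ ys : List R, IsMaximalFilterRegularIn a b M (xs ++ ys)) ∧
      ∀ xs : List R, IsMaximalFilterRegularIn a b M xs →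
        (xs.length : ℕ∞) = filterGrade a b M) ∧
    -- the formulas for the filter grade
    (∀ (N : Type u) [AddCommGroup N] [Module R N] [Module.Finite R N],
      filterGrade a (Module.annihilator R N) M =
        ⨅ (i : ℕ) (_ : ¬ Module.support R (ExtMod R i N M) ⊆
          PrimeSpectrum.zeroLocus (a : Set R)), (i : ℕ∞)) ∧
    (∀ (N : Type u) [AddCommGroup N] [Module R N] [Module.Finite R N],
      filterGrade a (b ⊔ Module.annihilator R N) M =
        ⨅ (i : ℕ) (_ : ¬ Module.support R (GenLocalCohomology b i N M) ⊆
          PrimeSpectrum.zeroLocus (a : Set R)), (i : ℕ∞)) ∧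
    (filterGrade a b M =
      ⨅ (i : ℕ) (_ : ¬ Module.support R (ExtMod R i (R ⧸ b) M) ⊆
        PrimeSpectrum.zeroLocus (a : Set R)), (i : ℕ∞)) ∧
    (filterGrade a b M =
      ⨅ (i : ℕ) (_ : ¬ Module.support R (LocalCohomologyMod b i M) ⊆
        PrimeSpectrum.zeroLocus (a : Set R)), (i : ℕ∞)) := by
  have ext (N : Type u) [AddCommGroup N] [Module R N] [Module.Finite R N] (n : ℕ) :=
    exists_isFilterRegularIn_iff_ext a (Module.annihilator R N) M N
      Ideal.le_radical Ideal.le_radical n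
  have quot (n : ℕ) := exists_isFilterRegularIn_iff_ext a b M (R ⧸ b)
    (by rw [Ideal.annihilator_quotient]; exact Ideal.le_radical)
    (by rw [Ideal.annihilator_quotient]; exact Ideal.le_radical) n
  have gen (N : Type u) [AddCommGroup N] [Module R N] [Module.Finite R N] (n : ℕ) :=
    exists_isFilterRegularIn_iff_colimit a b M N rfl (fun i => GenLocalCohomology b i N M)
      (fun i => exists_genLocalCohomology_cocone b i N M) n
  -- `Ann R = 0`, so local cohomology is the case `N = R` with no enlargement of `b`.
  have hR : b = b ⊔ Module.annihilator R R :=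
    (sup_eq_left.2 fun r hr => by
      have h := Module.mem_annihilator.1 hr 1
      rw [smul_eq_mul, mul_one] at h
      exact h ▸ b.zero_mem).symm
  have loc (n : ℕ) := exists_isFilterRegularIn_iff_colimit a b M R hR
    (fun i => LocalCohomologyMod b i M) (fun i => exists_localCohomology_cocone b i M) n
  have all (h : Module.support R (M ⧸ (b • (⊤ : Submodule R M))) ⊆
      PrimeSpectrum.zeroLocus (a : Set R)) (n : ℕ) := exists_isFilterRegularIn_of_support a b n M h
  refine ⟨fun n hn => ?_, ⟨fun h n _ => all h n, fun h => ?_⟩, fun h => ?_, fun h => ⟨fun xs hxs =>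
    exists_isMaximalFilterRegularIn h hxs, fun xs hxs => ?_⟩, fun N _ _ _ =>
    filterGrade_eq_iInf (ext N), fun N _ _ _ => filterGrade_eq_iInf (gen N),
    filterGrade_eq_iInf quot, filterGrade_eq_iInf loc⟩
  · tfae_have 1 → 2 := by
      rintro ⟨zs, rfl, hzs⟩ xs hxs hl
      exact hzs.exists_extension hxs hl.le
    tfae_have 2 → 1 := by
      intro h
      obtain ⟨ys, hys⟩ := h [] ⟨isFilterRegular_nil a _, by simp⟩ hn
      exact ⟨_, hys⟩
    tfae_have 1 ↔ 3 := quot n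
    tfae_have 1 → 4 := by
      intro h N _ _ _ hN
      -- Equal supports give equal radicals, which is all the `Ext` criterion needs.
      have hrad : b.radical = (Module.annihilator R N).radical := by
        rw [Module.support_eq_zeroLocus] at hN
        rw [← PrimeSpectrum.vanishingIdeal_zeroLocus_eq_radical,
          ← PrimeSpectrum.vanishingIdeal_zeroLocus_eq_radical, hN]
      exact (exists_isFilterRegularIn_iff_ext a b M N (Ideal.le_radical.trans hrad.le)
        (Ideal.le_radical.trans hrad.ge) n).1 h
    tfae_have 4 → 3 := fun h => h (R ⧸ b) (by
      rw [Module.support_eq_zeroLocus, Ideal.annihilator_quotient])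
    tfae_have 1 ↔ 5 := loc n
    tfae_have 1 → 6 := by
      intro h N _ _ _ hN
      refine (gen N n).1 ?_
      rwa [sup_eq_left.2 hN]
    tfae_have 6 → 1 := by
      intro h
      have := (gen R n).2 (h R (by rw [hR]; exact le_sup_right))
      rwa [← hR] at this
    tfae_finish
  -- Otherwise the empty sequence extends to a maximal one, whose length bounds all others.
  · by_contra hns
    obtain ⟨ys, hys⟩ := exists_isMaximalFilterRegularIn hns (xs := [])
      ⟨isFilterRegular_nil a M, by simp⟩
    obtain ⟨zs, hl, hzs⟩ := h (ys.length + 1) (by omega)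
    have := hys.length_le hzs
    simp at this
    omega
  · refine ENat.eq_top_iff_forall_ge.2 fun n => ?_
    obtain ⟨xs, rfl, hxs⟩ := all h n
    exact le_iSup₂_of_le (f := fun (xs : List R) (_ : IsFilterRegularIn a b M xs) =>
      (xs.length : ℕ∞)) xs hxs le_rfl
  · exact le_antisymm (le_iSup₂_of_le (f := fun (xs : List R) (_ : IsFilterRegularIn a b M xs) =>
      (xs.length : ℕ∞)) xs hxs.1 le_rfl)
      (iSup₂_le fun zs hzs => by exact_mod_cast hxs.length_le hzs)
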